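/- Let $M$ be a smooth ($\mathcal C^\infty$), finite-dimensional, paracompact, Hausdorff manifold, let $\nabla$ be a smooth affine connection on $M$ with torsion $T(X,Y)=\nabla_XY-\nabla_YX-[X,Y]$, and let $\overline\nabla$ be the associated torsion-free connection $\overline\nabla_XY=\nabla_XY-\tfrac12T(X,Y)$, which has the same geodesics. Let $X_1,X_2$ be smooth vector fields on $M$, let $x\in M$ and $v_x\in T_xM$. For a vector field $X$ on $M$, let $X^V$ be its vertical lift, the vector field on $TM$ given by $X^V(w_y)=\left.\frac{\mathrm d}{\mathrm dt}\right|_{t=0}(w_y+tX(y))$ for $y\in M$, $w_y\in T_yM$, and let $\Phi^{X^V}_t$ be its flow. For $i=1,2$ let $\gamma_i$ be a geodesic of $\nabla$, defined on an open interval containing $0$, with $\gamma_i(0)=x$ and $\gamma_i'(0)=X_i(x)$. Let $\tau_\gamma^{(t,s)}\colon T_{\gamma(s)}M\to T_{\gamma(t)}M$ and $\overline\tau_\gamma^{(t,s)}$ denote parallel transport along $\gamma$ with respect to $\nabla$ and $\overline\nabla$, respectively. For $t$ near $0$ define the curves in $TM$ $$\Upsilon_3^Z(t)=\Phi^{X_2^V}_{-t}\,\tau_{\gamma_1}^{(0,t)}\,\Phi^{X_2^V}_{t}\,\tau_{\gamma_1}^{(t,0)}\,\Phi^{X_1^V}_{-t}\,\tau_{\gamma_2}^{(0,t)}\,\Phi^{X_1^V}_{t}\,\tau_{\gamma_2}^{(t,0)}(v_x),$$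 $$\Upsilon_4^Z(t)=\Phi^{X_2^V}_{-t}\,\overline\tau_{\gamma_1}^{(0,t)}\,\Phi^{X_2^V}_{t}\,\overline\tau_{\gamma_1}^{(t,0)}\,\Phi^{X_1^V}_{-t}\,\overline\tau_{\gamma_2}^{(0,t)}\,\Phi^{X_1^V}_{t}\,\overline\tau_{\gamma_2}^{(t,0)}(v_x),$$ where juxtaposition denotes composition. Then, for $\Upsilon\in\{\Upsilon_3^Z,\Upsilon_4^Z\}$, we have $\Upsilon(0)=v_x$, $\Upsilon'(0)=0$, the second derivative of $\Upsilon$ at $0$ exists, and $$\frac12\left.\frac{\mathrm d^2}{\mathrm dt^2}\right|_{t=0}\Upsilon(t)=\langle X_1\colon X_2\rangle^V(v_x),\qquad\text{where }\ \langle X_1\colon X_2\rangle=\nabla_{X_1}X_2+\nabla_{X_2}X_1 .$$ Here, since $\Upsilon'(0)=0$, the second derivative at $0$ is the tangent vector $w\in T_{v_x}TM$ with $w(f)=\left.\frac{\mathrm d^2}{\mathrm dt^2}\right|_{t=0}f(\Upsilon(t))$ for every real function $f$ that is smooth near $v_x$. -/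

import Mathlib

open Bundle Set Filter Manifold
open scoped Topology ContDiff

noncomputable section

namespace SymProd

section General

variable {F : Type*} [NormedAddCommGroup F] [NormedSpace ℝ F]
  {K : Type*} [TopologicalSpace K] {J : ModelWithCorners ℝ F K}
  {N : Type*} [TopologicalSpace N] [ChartedSpace K N]

variable (J) in
/-- The tangent vector `γ'(t)` of a curve `γ` in a manifold. -/
def velocity (γ : ℝ → N) (t : ℝ) : TangentSpace J (γ t) :=
  mfderiv 𝓘(ℝ, ℝ) J γ t (1 : ℝ)

open Classical in
/-- The flow of a complete vector field `V`: `flow V t p` is the value at time `t` of the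
integral curve `c : ℝ → N` of `V` with `c 0 = p`.
(If there is no such curve, the value is `p`; this does not occur for complete fields.) -/
def flow (V : ∀ p : N, TangentSpace J p) (t : ℝ) (p : N) : N :=
  if h : ∃ c : ℝ → N, c 0 = p ∧ IsMIntegralCurve c V then h.choose t else p

variable (J) in
/-- `w ∈ T_p N` is the second derivative at `t₀` of the curve `c` in `N`, where `c t₀ = p` and
`c'(t₀) = 0`. For a curve in a manifold the second derivative at `t₀` is a tangent vector
exactly when the first one vanishes there; it is then the vector `w` that differentiates
functions by `w(f) = (f ∘ c)''(t₀)`, for all real functions `f` that are smooth near `p`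
(among them the coordinates of any chart at `p`). -/
structure HasSecondDerivAt (c : ℝ → N) (t₀ : ℝ) (p : N) (w : TangentSpace J p) : Prop where
  base : c t₀ = p
  mdifferentiable : ∀ᶠ t in 𝓝 t₀, MDifferentiableAt 𝓘(ℝ, ℝ) J c t
  critical : HasMFDerivAt 𝓘(ℝ, ℝ) J c t₀ 0
  second : ∀ f : N → ℝ, ContMDiffAt J 𝓘(ℝ, ℝ) ∞ f p →
    HasDerivAt (deriv (f ∘ c)) (mfderiv J 𝓘(ℝ, ℝ) f p w : ℝ) t₀

end General

variable {E : Type*} [NormedAddCommGroup E] [NormedSpace ℝ E]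
  {H : Type*} [TopologicalSpace H] {I : ModelWithCorners ℝ E H}
  {M : Type*} [TopologicalSpace M] [ChartedSpace H M] [IsManifold I ∞ M]

/-- The vertical lift `vlft(v, u) = d/dt|_{t = 0} (v + t u)` of `u ∈ T_x M` to `v ∈ T_x M`,
a tangent vector to `TM` at `v`. (The velocity has its base point at `v + 0 u`, that is, at `v`.) -/
def vlft {x : M} (v u : TangentSpace I x) :
    TangentSpace I.tangent (⟨x, v⟩ : TangentBundle I M) :=
  velocity I.tangent (fun t : ℝ ↦ (⟨x, v + t • u⟩ : TangentBundle I M)) 0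

/-- The vertical lift `X^V` of a vector field `X` on `M`, a vector field on `TM`. -/
def verticalLift (X : ∀ x : M, TangentSpace I x) (p : TangentBundle I M) :
    TangentSpace I.tangent p :=
  vlft p.2 (X p.1)

/-- The symmetric product `⟨X : Y⟩ = ∇_X Y + ∇_Y X` of two vector fields.
(In Mathlib `∇ Y x (X x)` stands for `(∇_X Y)(x)`.) -/
def symmetricProduct (cov : CovariantDerivative I E (TangentSpace I : M → Type _))
    (X Y : ∀ x : M, TangentSpace I x) (x : M) : TangentSpace I x :=
  cov Y x (X x) + cov X x (Y x)

/-- The zero-torsion connection `∇̄_X Y = ∇_X Y - (1/2) T(X, Y)` associated with `∇`,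
where `T` is the torsion of `∇`. The correction is entered as the equal term `(1/2) T(Y, X)`;
see `torsionFree_apply`. -/
def torsionFree [FiniteDimensional ℝ E]
    (cov : CovariantDerivative I E (TangentSpace I : M → Type _)) :
    CovariantDerivative I E (TangentSpace I : M → Type _) :=
  haveI : CompleteSpace E := FiniteDimensional.complete ℝ E
  haveI : IsManifold I 2 M := IsManifold.of_le (n := ∞) (by norm_cast)
  cov.addOneForm fun x ↦ (1 / 2 : ℝ) • cov.torsion x

theorem torsionFree_apply [FiniteDimensional ℝ E] [CompleteSpace E] [IsManifold I 2 M]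
    (cov : CovariantDerivative I E (TangentSpace I : M → Type _))
    (X Y : ∀ x : M, TangentSpace I x) (x : M) :
    torsionFree cov Y x (X x) = cov Y x (X x) - (1 / 2 : ℝ) • cov.torsion x (X x) (Y x) := by
  rw [cov.torsion_antisymm (X x) (Y x), smul_neg, sub_neg_eq_add]
  rfl

/-- `w` is the covariant derivative `∇_{γ'(t₀)} Y` at `t₀` of the vector field `Y` along `γ`.
If `Y(t) = S(γ(t))` for a vector field `S` on `M`, it is `∇_{γ'(t₀)} S`. In general (where `γ`
is not an immersion, `Y` need not extend to `M`) one writes `Y`, near `t₀`, as a combination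
`∑ aᵢ(t) Sᵢ(γ(t))` of vector fields of this kind and applies the Leibniz rule. The result does
not depend on the choice of `aᵢ`, `Sᵢ`. -/
def HasCovDerivAlong (cov : CovariantDerivative I E (TangentSpace I : M → Type _))
    (γ : ℝ → M) (Y : ∀ t, TangentSpace I (γ t)) (t₀ : ℝ) (w : TangentSpace I (γ t₀)) : Prop :=
  MDifferentiableAt 𝓘(ℝ, ℝ) I γ t₀ ∧
  ∃ (n : ℕ) (a : Fin n → ℝ → ℝ) (S : Fin n → ∀ x : M, TangentSpace I x),
    (∀ i, ContMDiff I I.tangent ∞ fun x ↦ (⟨x, S i x⟩ : TangentBundle I M)) ∧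
    (∀ i, DifferentiableAt ℝ (a i) t₀) ∧
    (∀ᶠ t in 𝓝 t₀, Y t = ∑ i, a i t • S i (γ t)) ∧
    w = ∑ i, (deriv (a i) t₀ • S i (γ t₀) + a i t₀ • cov (S i) (γ t₀) (velocity I γ t₀))

/-- `Y` is parallel along `γ` on the set `U` of parameters: `∇_{γ'(t)} Y(t) = 0` for `t ∈ U`. -/
def IsParallelOn (cov : CovariantDerivative I E (TangentSpace I : M → Type _))
    (γ : ℝ → M) (Y : ∀ t, TangentSpace I (γ t)) (U : Set ℝ) : Prop :=
  ∀ t ∈ U, HasCovDerivAlong cov γ Y t 0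

/-- `γ` is a geodesic on the (open) set `U` of parameters: it is smooth and
`∇_{γ'(t)} γ'(t) = 0` there. -/
def IsGeodesicOn (cov : CovariantDerivative I E (TangentSpace I : M → Type _))
    (γ : ℝ → M) (U : Set ℝ) : Prop :=
  ContMDiffOn 𝓘(ℝ, ℝ) I ∞ γ U ∧ IsParallelOn cov γ (velocity I γ) U

open Classical in
/-- Parallel transport `τ_γ^{(t, s)} : T_{γ(s)} M → T_{γ(t)} M`, as a map on the total space `TM`:
a point `p ∈ T_{γ(s)} M` is sent to `Y(t)`, where `Y` is the vector field along `γ` that is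
parallel (in a neighbourhood of the parameters between `s` and `t`) and has `Y(s) = p`.
(Where there is no such `Y`, for instance if `p ∉ T_{γ(s)} M`, the value is `p`.) -/
def parallelTransport (cov : CovariantDerivative I E (TangentSpace I : M → Type _))
    (γ : ℝ → M) (t s : ℝ) (p : TangentBundle I M) : TangentBundle I M :=
  if h : ∃ Y : ∀ r, TangentSpace I (γ r),
      (∃ U : Set ℝ, IsOpen U ∧ uIcc s t ⊆ U ∧ IsParallelOn cov γ Y U) ∧
      (⟨γ s, Y s⟩ : TangentBundle I M) = p
  then ⟨γ t, h.choose t⟩ else p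

/-- The curve
`t ↦ Φ^{X₂^V}_{-t} τ_{γ₁}^{(0,t)} Φ^{X₂^V}_t τ_{γ₁}^{(t,0)}
     Φ^{X₁^V}_{-t} τ_{γ₂}^{(0,t)} Φ^{X₁^V}_t τ_{γ₂}^{(t,0)} (p)`
in `TM`, with the parallel transport of the given connection. -/
def upsilon (cov : CovariantDerivative I E (TangentSpace I : M → Type _))
    (X₁ X₂ : ∀ x : M, TangentSpace I x) (γ₁ γ₂ : ℝ → M) (p : TangentBundle I M) (t : ℝ) :
    TangentBundle I M :=
  flow (verticalLift X₂) (-t) <| parallelTransport cov γ₁ 0 t <|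
  flow (verticalLift X₂) t <| parallelTransport cov γ₁ t 0 <|
  flow (verticalLift X₁) (-t) <| parallelTransport cov γ₂ 0 t <|
  flow (verticalLift X₁) t <| parallelTransport cov γ₂ t 0 p

end SymProd

end

/-!
The curve `Υ` never leaves the fibre over `x`. The vertical lift `X^V` is tangent to the fibres of
`TM` and constant along each of them, so its flow is the translation `w_y ↦ w_y + t X(y)`
(`flow_verticalLift`). Parallel transport is linear, and a block
`Φ^{X^V}_{-t} τ_γ^{(0,t)} Φ^{X^V}_t τ_γ^{(t,0)}` therefore acts on `T_x M` as the translation by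
`t (g(t) - g(0))`, where `g(t) = τ_γ^{(0,t)} X(γ(t))` is a curve in the single vector space `T_x M`.
Since `g'(t) = τ_γ^{(0,t)} ∇_{γ'(t)} X` is continuous, `t (g(t) - g(0))` has vanishing first
derivative at `0` and second derivative `2 g'(0) = 2 ∇_{γ'(0)} X` (`exists_fibre_curve`). The two
blocks contribute `2 ∇_{X₂} X₁` and `2 ∇_{X₁} X₂`, whose sum is `2 ⟨X₁ : X₂⟩`
(`hasSecondDerivAt_upsilon`).

Parallel transport is made explicit in a frame of globally defined fields around `x`
(`GlobalFrame`): a field along `γ` is parallel exactly when its coordinates solve a linear equation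
`y' = -A(t) y` (`hasDerivAt_of_hasCovDerivAlong`, `hasCovDerivAlong_frameSymm`). With the
fundamental solution `P` and its inverse `Q`, the transport from `s` to `t` is `P(t) Q(s)`
(`parallelTransport_eq`); uniqueness holds because `Q(t) y(t)` is constant for every solution `y`.

The argument uses the connection only through the fact that it maps smooth fields to smooth fields
(`PreservesSmooth`). This passes from `∇` to the torsion-free connection, and both have the same
symmetric product because the torsion is antisymmetric (`symmetricProduct_torsionFree`).
-/

noncomputable section

namespace SymProd

/-! ### Linear differential equations -/

open scoped NNReal in
/-- Locally near `0`, the linear equation `y' = -A(t) y` with `A` continuous has a fundamental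
solution `P` with inverse `Q`. -/
theorem exists_fundamentalSolution {G : Type*} [NormedAddCommGroup G] [NormedSpace ℝ G]
    [CompleteSpace G] {A : ℝ → G →L[ℝ] G} (hA : ∀ᶠ t in 𝓝 0, ContinuousAt A t) :
    ∃ P Q : ℝ → G →L[ℝ] G, Q 0 = 1 ∧
      ∀ᶠ t in 𝓝 0, HasDerivAt P (-(A t * P t)) t ∧ HasDerivAt Q (Q t * A t) t ∧
        P t * Q t = 1 ∧ Q t * P t = 1 := by
  -- Picard–Lindelöf on the unit ball around `1`, where the right-hand side is bounded by `L`.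
  set K : ℝ≥0 := ‖A 0‖₊ + 1 with hK
  have hA0 : ∀ᶠ t in 𝓝 0, ‖A t‖ < K :=
    hA.self_of_nhds.norm.eventually_lt continuousAt_const (by simp [hK])
  obtain ⟨ε, hε, h⟩ := Metric.eventually_nhds_iff.1 (hA.and hA0)
  set L : ℝ≥0 := K * (‖(1 : G →L[ℝ] G)‖₊ + 1) with hL
  obtain ⟨δ, hδ, hδε, hδL⟩ : ∃ δ > 0, δ < ε ∧ L * δ ≤ 1 := by
    refine ⟨min (ε / 2) (1 / (L + 1)), by positivity, by
      have := min_le_left (ε / 2) (1 / ((L : ℝ) + 1)); linarith, ?_⟩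
    calc (L : ℝ) * min (ε / 2) (1 / (L + 1)) ≤ L * (1 / (L + 1)) := by
          gcongr; exact min_le_right _ _
      _ ≤ 1 := by
          rw [mul_one_div, div_le_one (by positivity)]; linarith
  have hI {t : ℝ} (ht : t ∈ Icc (-δ) δ) : dist t 0 < ε := by
    rw [Real.dist_0_eq_abs]; exact (abs_le.2 ht).trans_lt hδε
  have h0 : (0 : ℝ) ∈ Icc (-δ) δ := by constructor <;> linarith
  have hPL : IsPicardLindelof (fun t (B : G →L[ℝ] G) ↦ -(A t * B)) ⟨0, h0⟩ 1 1 0 L K := by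
    refine ⟨fun t ht ↦ ?_, fun B _ t ht ↦ ?_, fun t ht B hB ↦ ?_, ?_⟩
    · refine LipschitzWith.lipschitzOnWith (LipschitzWith.of_dist_le_mul fun B C ↦ ?_)
      rw [dist_neg_neg, dist_eq_norm, dist_eq_norm, ← mul_sub]
      exact (norm_mul_le _ _).trans (by gcongr; exact (h (hI ht)).2.le)
    · exact ((h (hI ht)).1.mul continuousAt_const).neg.continuousWithinAt
    · rw [norm_neg]
      refine (norm_mul_le _ _).trans ?_
      rw [hL]; push_cast
      gcongr
      · exact (h (hI ht)).2.le
      · have : ‖B - 1‖ ≤ 1 := by simpa [dist_eq_norm] using hB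
        calc ‖B‖ = ‖1 + (B - 1)‖ := by simp
          _ ≤ _ := (norm_add_le _ _).trans (by gcongr)
    · simpa using hδL
  obtain ⟨P, hP0, hP⟩ := hPL.exists_eq_forall_mem_Icc_hasDerivWithinAt₀
  have hP' : ∀ᶠ t in 𝓝 0, HasDerivAt P (-(A t * P t)) t := by
    filter_upwards [Ioo_mem_nhds (neg_lt_zero.2 hδ) hδ] with t ht
    exact (hP t (Ioo_subset_Icc_self ht)).hasDerivAt (Icc_mem_nhds ht.1 ht.2)
  have hP0 : P 0 = 1 := hP0
  -- The units are open, so `P` stays invertible near `0`, and `Q` is its inverse.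
  have hu : ∀ᶠ t in 𝓝 0, IsUnit (P t) :=
    hP'.self_of_nhds.continuousAt.eventually_mem
      (Units.isOpen.mem_nhds (by rw [hP0]; exact isUnit_one))
  refine ⟨P, fun t ↦ Ring.inverse (P t), by simp [hP0], ?_⟩
  filter_upwards [hP', hu] with t ht hut
  refine ⟨ht, ?_, Ring.mul_inverse_cancel _ hut, Ring.inverse_mul_cancel _ hut⟩
  obtain ⟨u, hu⟩ := hut
  have h1 : HasFDerivAt Ring.inverse _ (P t) := hu ▸ hasFDerivAt_ringInverse (𝕜 := ℝ) u
  refine (h1.comp_hasDerivAt t ht).congr_deriv ?_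
  have h2 : A t * P t * (↑u⁻¹ : G →L[ℝ] G) = A t := by rw [← hu, mul_assoc, u.mul_inv, mul_one]
  rw [← hu, Ring.inverse_unit, neg_apply, ContinuousLinearMap.mulLeftRight_apply, mul_neg,
    neg_mul, neg_neg, mul_assoc, hu, h2]

variable {E : Type*} [NormedAddCommGroup E] [NormedSpace ℝ E]
  {H : Type*} [TopologicalSpace H] {I : ModelWithCorners ℝ E H}
  {M : Type*} [TopologicalSpace M] [ChartedSpace H M] [IsManifold I ∞ M]

/-! ### The vertical lift -/

variable (I) in
/-- The inclusion of the fibre `T_x M` into `TM`. Its domain is the model space `E`, which is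
definitionally `T_x M` but carries the norm that calculus requires. -/
def fibreInclusion (x : M) (u : E) : TangentBundle I M := ⟨x, u⟩

theorem contMDiff_fibreInclusion (x : M) :
    ContMDiff 𝓘(ℝ, E) I.tangent ∞ (fibreInclusion I x) := by
  intro u
  rw [contMDiffAt_totalSpace]
  refine ⟨contMDiffAt_const, ?_⟩
  let l : E →L[ℝ] E := (trivializationAt E (TangentSpace I) x).continuousLinearMapAt ℝ x
  refine (l.contMDiff u).congr_of_eventuallyEq (Eventually.of_forall fun w ↦ ?_)
  exact (Trivialization.continuousLinearMapAt_apply_of_mem (R := ℝ)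
    (trivializationAt E (TangentSpace I) x)
    (FiberBundle.mem_baseSet_trivializationAt' x) w).symm

theorem comp_one_smulRight {F G : Type*} [NormedAddCommGroup F] [NormedSpace ℝ F]
    [NormedAddCommGroup G] [NormedSpace ℝ G] (L : F →L[ℝ] G) (u : F) :
    L ∘L ((1 : ℝ →L[ℝ] ℝ).smulRight u) = (1 : ℝ →L[ℝ] ℝ).smulRight (L u) :=
  ContinuousLinearMap.ext fun s ↦ map_smul L s u

theorem hasMFDerivAt_fibreInclusion_line (x : M) (v u : E) (t : ℝ) :
    HasMFDerivAt 𝓘(ℝ, ℝ) I.tangent (fun s : ℝ ↦ fibreInclusion I x (v + s • u)) t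
      ((1 : ℝ →L[ℝ] ℝ).smulRight
        (mfderiv 𝓘(ℝ, E) I.tangent (fibreInclusion I x) (v + t • u) u)) := by
  have h1 := ((contMDiff_fibreInclusion (I := I) x (v + t • u)).mdifferentiableAt
    (by simp)).hasMFDerivAt
  have h2 : HasMFDerivAt 𝓘(ℝ, ℝ) 𝓘(ℝ, E) (fun t : ℝ ↦ v + t • u) t
      ((1 : ℝ →L[ℝ] ℝ).smulRight u) := by
    have := (((hasDerivAt_id t).smul_const u).const_add v)
    simp only [one_smul] at this
    exact this.hasFDerivAt.hasMFDerivAt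
  exact (HasMFDerivAt.comp t h1 h2).congr_mfderiv (comp_one_smulRight (F := E) (G := E × E) _ u)

theorem vlft_eq (x : M) (v u : E) :
    vlft (I := I) (x := x) v u = mfderiv 𝓘(ℝ, E) I.tangent (fibreInclusion I x) v u := by
  have h := (hasMFDerivAt_fibreInclusion_line (I := I) x v u 0).mfderiv
  have h0 : v + (0 : ℝ) • u = v := by simp
  have h1 : (mfderiv 𝓘(ℝ, E) I.tangent (fibreInclusion I x) (v + (0 : ℝ) • u) : E →L[ℝ] E × E) u =
      (mfderiv 𝓘(ℝ, E) I.tangent (fibreInclusion I x) v : E →L[ℝ] E × E) u := by rw [h0]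
  refine (congrArg (fun L : ℝ →L[ℝ] E × E ↦ L 1) h).trans (Eq.trans ?_ h1)
  exact one_smul ℝ _

/-- The vertical lift of `u` differentiates a function on `TM` in the direction `u` of the fibre. -/
theorem mfderiv_vlft {G : Type*} [NormedAddCommGroup G] [NormedSpace ℝ G]
    {K : Type*} [TopologicalSpace K] {J : ModelWithCorners ℝ G K}
    {N : Type*} [TopologicalSpace N] [ChartedSpace K N] (p : TangentBundle I M)
    {f : TangentBundle I M → N} (hf : MDifferentiableAt I.tangent J f p)
    (u : TangentSpace I p.1) :
    mfderiv I.tangent J f p (vlft p.2 u) =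
      mfderiv 𝓘(ℝ, E) J (f ∘ fibreInclusion I p.1) p.2 u := by
  have key (x : M) (w u' : E) (hf' : MDifferentiableAt I.tangent J f (fibreInclusion I x w)) :
      mfderiv I.tangent J f (fibreInclusion I x w) (vlft (I := I) (x := x) w u') =
        mfderiv 𝓘(ℝ, E) J (f ∘ fibreInclusion I x) w u' := by
    have hκ : MDifferentiableAt 𝓘(ℝ, E) I.tangent (fibreInclusion I x) w :=
      (contMDiff_fibreInclusion x w).mdifferentiableAt (by simp)
    have h := congrArg (fun L : E →L[ℝ] G ↦ L u') (mfderiv_comp w hf' hκ)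
    exact (congrArg (mfderiv I.tangent J f (fibreInclusion I x w)) (vlft_eq x w u')).trans h.symm
  exact key p.1 p.2 u hf

theorem _root_.IsMIntegralCurve.hasMFDerivAt_comp_verticalLift
    {G : Type*} [NormedAddCommGroup G] [NormedSpace ℝ G]
    {K : Type*} [TopologicalSpace K] {J : ModelWithCorners ℝ G K}
    {N : Type*} [TopologicalSpace N] [ChartedSpace K N]
    {X : ∀ x : M, TangentSpace I x} {c : ℝ → TangentBundle I M}
    (hc : IsMIntegralCurve c (verticalLift X)) {f : TangentBundle I M → N} {t : ℝ}
    (hf : MDifferentiableAt I.tangent J f (c t)) : HasMFDerivAt 𝓘(ℝ, ℝ) J (fun t ↦ f (c t)) t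
      ((1 : ℝ →L[ℝ] ℝ).smulRight
        (mfderiv 𝓘(ℝ, E) J (f ∘ fibreInclusion I (c t).1) (c t).2 (X (c t).1))) := by
  have h := HasMFDerivAt.comp t hf.hasMFDerivAt (hc t)
  rw [← mfderiv_vlft (c t) hf]
  exact h.congr_mfderiv (comp_one_smulRight (F := E × E) (G := G) _ (verticalLift X (c t)))

/-! ### Coordinates of tangent vectors -/

variable (I) in
/-- The coordinates in `E` of a tangent vector at `y`, with respect to the trivialization of `TM`
at `x₀`. The value is zero if `y` is outside of `frameDomain I x₀`. -/
def frameCoord (x₀ y : M) : TangentSpace I y →L[ℝ] E :=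
  (trivializationAt E (TangentSpace I) x₀).continuousLinearMapAt ℝ y

variable (I) in
/-- The tangent vector at `y` with given coordinates in the trivialization of `TM` at `x₀`. -/
def frameSymm (x₀ y : M) : E →L[ℝ] TangentSpace I y :=
  (trivializationAt E (TangentSpace I) x₀).symmL ℝ y

variable (I) in
/-- The domain of the trivialization of `TM` at `x₀`. -/
def frameDomain (x₀ : M) : Set M := (trivializationAt E (TangentSpace I : M → Type _) x₀).baseSet

theorem isOpen_frameDomain (x₀ : M) : IsOpen (frameDomain I x₀) :=
  (trivializationAt E (TangentSpace I : M → Type _) x₀).open_baseSet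

theorem mem_frameDomain (x₀ : M) : x₀ ∈ frameDomain I x₀ :=
  FiberBundle.mem_baseSet_trivializationAt' x₀

theorem frameSymm_frameCoord {x₀ y : M} (hy : y ∈ frameDomain I x₀) (u : TangentSpace I y) :
    frameSymm I x₀ y (frameCoord I x₀ y u) = u :=
  Trivialization.symmL_continuousLinearMapAt _ hy u

theorem frameCoord_frameSymm {x₀ y : M} (hy : y ∈ frameDomain I x₀) (u : E) :
    frameCoord I x₀ y (frameSymm I x₀ y u) = u :=
  Trivialization.continuousLinearMapAt_symmL _ hy u

theorem trivializationAt_snd {x₀ : M} (p : TangentBundle I M) (hp : p.1 ∈ frameDomain I x₀) :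
    (trivializationAt E (TangentSpace I) x₀ p).2 = frameCoord I x₀ p.1 p.2 :=
  (Trivialization.continuousLinearMapAt_apply_of_mem (R := ℝ) _ hp p.2).symm

theorem contMDiffAt_frameCoord {x₀ : M} (p : TangentBundle I M) (hp : p.1 ∈ frameDomain I x₀) :
    ContMDiffAt I.tangent 𝓘(ℝ, E) ∞
      (fun q : TangentBundle I M ↦ frameCoord I x₀ q.1 q.2) p := by
  have h := ((trivializationAt E (TangentSpace I : M → Type _) x₀).contMDiffAt_iff
    (IB := I) (IM := I.tangent) (n := ∞) (f := id) (x₀ := p)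
    ((Trivialization.mem_source _).2 hp)).1 contMDiffAt_id
  refine h.2.congr_of_eventuallyEq ?_
  filter_upwards [((isOpen_frameDomain x₀).preimage
    (FiberBundle.continuous_proj E (TangentSpace I : M → Type _))).mem_nhds hp] with q hq
  exact (trivializationAt_snd q hq).symm

theorem eq_mk_of_frameCoord_eq {x : M} {p : TangentBundle I M} (hp : p.1 = x)
    {u : TangentSpace I x} (h : frameCoord I x p.1 p.2 = frameCoord I x x u) : p = ⟨x, u⟩ := by
  obtain ⟨y, w⟩ := p
  obtain rfl : y = x := hp
  congr 1
  rw [← frameSymm_frameCoord (mem_frameDomain y) w, ← frameSymm_frameCoord (mem_frameDomain y) u]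
  exact congrArg _ h

/-! ### The flow of the vertical lift -/

/-- The integral curves of a vertical lift are affine lines in the fibres: their projection to `M`
is an integral curve of the zero field, hence constant, and their fibre coordinate has constant
derivative. -/
theorem isMIntegralCurve_verticalLift_eq [I.Boundaryless] [T2Space M]
    (X : ∀ x : M, TangentSpace I x) {c : ℝ → TangentBundle I M}
    (hc : IsMIntegralCurve c (verticalLift X)) (t : ℝ) :
    c t = ⟨(c 0).1, (c 0).2 + t • X (c 0).1⟩ := by
  have hbase : ∀ t, (c t).1 = (c 0).1 := by
    have h1 : IsMIntegralCurve (fun t ↦ (c t).1) (0 : ∀ x : M, TangentSpace I x) := by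
      intro t
      have h := hc.hasMFDerivAt_comp_verticalLift (f := TotalSpace.proj) (J := I) (t := t)
        (mdifferentiableAt_proj (TangentSpace I : M → Type _))
      have h00 : mfderiv 𝓘(ℝ, E) I ((TotalSpace.proj : TangentBundle I M → M) ∘
          fibreInclusion I (c t).1) (c t).2 = 0 := mfderiv_const
      rw [h00] at h
      exact h
    have h2 : IsMIntegralCurve (fun _ ↦ (c 0).1) (0 : ∀ x : M, TangentSpace I x) := by
      intro t
      have h : HasMFDerivAt 𝓘(ℝ, ℝ) I (fun _ : ℝ ↦ (c 0).1) t 0 := hasMFDerivAt_const _ _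
      have h0 : (0 : ℝ →L[ℝ] E) = (1 : ℝ →L[ℝ] ℝ).smulRight (0 : E) :=
        ContinuousLinearMap.ext fun s ↦ (smul_zero s).symm
      exact h.congr_mfderiv h0
    have h3 := isMIntegralCurve_Ioo_eq_of_contMDiff_boundaryless (t₀ := 0)
      (contMDiff_zeroSection ℝ (TangentSpace I : M → Type _)) h1 h2 rfl
    exact congrFun h3
  set x := (c 0).1 with hx
  have hfib : ∀ t, HasDerivAt (fun t ↦ frameCoord I x (c t).1 (c t).2)
      (frameCoord I x x (X x)) t := by
    intro t
    have hm : (c t).1 ∈ frameDomain I x := by rw [hbase t]; exact mem_frameDomain x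
    have h := hc.hasMFDerivAt_comp_verticalLift (t := t)
      ((contMDiffAt_frameCoord (c t) hm).mdifferentiableAt (by simp))
    have h1 : HasFDerivAt (E := E) (frameCoord I x (c t).1 : E →L[ℝ] E)
      (frameCoord I x (c t).1 : E →L[ℝ] E) ((c t).2 : TangentSpace I (c t).1) :=
      ContinuousLinearMap.hasFDerivAt _
    have h2 : frameCoord I x (c t).1 (X (c t).1) = frameCoord I x x (X x) := by rw [hbase t]
    have h4 : mfderiv 𝓘(ℝ, E) 𝓘(ℝ, E) ((fun q : TangentBundle I M ↦ frameCoord I x q.1 q.2) ∘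
      fibreInclusion I (c t).1) (c t).2 (X (c t).1) = frameCoord I x x (X x) := by
      rw [← h2]
      exact congrArg (fun L : E →L[ℝ] E ↦ L (X (c t).1)) h1.hasMFDerivAt.mfderiv
    rw [h4] at h
    have h5 : HasFDerivAt (fun t ↦ frameCoord I x (c t).1 (c t).2)
      ((1 : ℝ →L[ℝ] ℝ).smulRight (frameCoord I x x (X x))) t := h.hasFDerivAt
    exact h5.hasDerivAt.congr_deriv (one_smul ℝ (frameCoord I x x (X x)))
  have hlin : ∀ t, HasDerivAt (fun t : ℝ ↦ frameCoord I x (c t).1 (c t).2 -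
      t • frameCoord I x x (X x)) 0 t := fun t ↦ by
    have h := (hfib t).sub ((hasDerivAt_id t).smul_const (frameCoord I x x (X x)))
    rw [one_smul, sub_self] at h
    exact h
  have hconst := is_const_of_deriv_eq_zero (fun t ↦ (hlin t).differentiableAt)
    (fun t ↦ (hlin t).deriv) t 0
  refine eq_mk_of_frameCoord_eq (hbase t) ?_
  rw [map_add, map_smul]
  simpa [sub_eq_iff_eq_add] using hconst

/-- The flow of a vertical lift translates each fibre. -/
theorem flow_verticalLift [I.Boundaryless] [T2Space M]
    (X : ∀ x : M, TangentSpace I x) (t : ℝ) (p : TangentBundle I M) :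
    flow (verticalLift X) t p = ⟨p.1, p.2 + t • X p.1⟩ := by
  have hex : ∃ c : ℝ → TangentBundle I M, c 0 = p ∧ IsMIntegralCurve c (verticalLift X) := by
    refine ⟨fun t ↦ ⟨p.1, p.2 + t • X p.1⟩, by simp, fun t ↦ ?_⟩
    have h := hasMFDerivAt_fibreInclusion_line (I := I) p.1 p.2 (X p.1) t
    have h1 := vlft_eq (I := I) p.1 (p.2 + t • X p.1) (X p.1)
    exact h.congr_mfderiv
      (congrArg (fun w : E × E ↦ (1 : ℝ →L[ℝ] ℝ).smulRight w) h1.symm)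
  rw [flow, dif_pos hex]
  have h := isMIntegralCurve_verticalLift_eq X hex.choose_spec.2 t
  rwa [hex.choose_spec.1] at h

/-! ### Connections that preserve smoothness -/

/-- `∇_X Y` is smooth for all smooth vector fields `X` and `Y`. Compared to
`ContMDiffCovariantDerivative`, this does not mention sections of the bundle `Hom(TM, TM)`, and is
easily checked for the torsion-free connection. -/
def PreservesSmooth (cov : CovariantDerivative I E (TangentSpace I : M → Type _)) : Prop :=
  ∀ X Y : ∀ x : M, TangentSpace I x,
    ContMDiff I I.tangent ∞ (fun x ↦ (⟨x, X x⟩ : TangentBundle I M)) →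
    ContMDiff I I.tangent ∞ (fun x ↦ (⟨x, Y x⟩ : TangentBundle I M)) →
    ContMDiff I I.tangent ∞ (fun x ↦ (⟨x, cov Y x (X x)⟩ : TangentBundle I M))

theorem preservesSmooth (cov : CovariantDerivative I E (TangentSpace I : M → Type _))
    [h : CovariantDerivative.ContMDiffCovariantDerivative cov ∞] : PreservesSmooth cov := by
  intro X Y hX hY
  have h1 := contMDiffOn_univ.1 (h.contMDiff.contMDiff (σ := Y) hY.contMDiffOn)
  exact ContMDiff.clm_bundle_apply h1 hX

theorem preservesSmooth_torsionFree [FiniteDimensional ℝ E]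
    {cov : CovariantDerivative I E (TangentSpace I : M → Type _)} (h : PreservesSmooth cov) :
    PreservesSmooth (torsionFree cov) := by
  have : CompleteSpace E := FiniteDimensional.complete ℝ E
  have : IsManifold I 2 M := IsManifold.of_le (n := ∞) (by norm_cast)
  have : IsManifold I (minSmoothness ℝ 2) M := by simpa using this
  have : IsManifold I (∞ + 1) M := IsManifold.of_le (n := ∞) (by simp)
  intro X Y hX hY
  have hb : ContMDiff I I.tangent ∞
      (fun x ↦ (⟨x, VectorField.mlieBracket I X Y x⟩ : TangentBundle I M)) := by
    intro x
    exact ContMDiffAt.mlieBracket_vectorField (m := ⊤) (n := ⊤) (hX x) (hY x) (by simp)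
  have h1 := (h X Y hX hY).sub_section (((((h X Y hX hY).sub_section (h Y X hY hX)).sub_section
    hb).const_smul_section (a := (1 / 2 : ℝ))))
  refine h1.congr fun x ↦ ?_
  rw [torsionFree_apply, cov.torsion_apply ((hX x).mdifferentiableAt (by simp))
    ((hY x).mdifferentiableAt (by simp))]
  rfl

theorem symmetricProduct_torsionFree [FiniteDimensional ℝ E]
    (cov : CovariantDerivative I E (TangentSpace I : M → Type _))
    (X Y : ∀ x : M, TangentSpace I x) :
    symmetricProduct (torsionFree cov) X Y = symmetricProduct cov X Y := by
  have : CompleteSpace E := FiniteDimensional.complete ℝ E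
  have : IsManifold I 2 M := IsManifold.of_le (n := ∞) (by norm_cast)
  funext x
  rw [symmetricProduct, torsionFree_apply, torsionFree_apply, cov.torsion_antisymm (Y x) (X x),
    symmetricProduct, smul_neg]
  abel

/-! ### Coordinates in a local frame -/

theorem cov_sum (cov : CovariantDerivative I E (TangentSpace I : M → Type _)) {ι : Type*}
    (s : Finset ι) {Z : ι → ∀ x : M, TangentSpace I x} {x : M}
    (hZ : ∀ i, MDifferentiableAt I I.tangent (fun y ↦ (⟨y, Z i y⟩ : TangentBundle I M)) x) :
    cov (fun y ↦ ∑ i ∈ s, Z i y) x = ∑ i ∈ s, cov (Z i) x := by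
  classical
  induction s using Finset.induction_on with
  | empty =>
    exact cov.isCovariantDerivativeOnUniv.zero (mem_univ x)
  | insert a s ha ih =>
    simp only [Finset.sum_insert ha, ← ih]
    exact cov.isCovariantDerivativeOnUniv.add (hZ a)
      (MDifferentiableAt.sum_section fun i _ ↦ hZ i)

variable (I) in
/-- A family of globally defined smooth vector fields that form a frame of `TM` near `x₀`. There,
they agree with the frame of the trivialization of `TM` at `x₀` given by the standard basis
`Module.finBasis ℝ E`. They have to be defined on all of `M` since `HasCovDerivAlong` expands
fields along curves in globally smooth fields only. -/
structure GlobalFrame [FiniteDimensional ℝ E] (x₀ : M) where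
  field : Fin (Module.finrank ℝ E) → ∀ x : M, TangentSpace I x
  smooth : ∀ i, ContMDiff I I.tangent ∞ fun x ↦ (⟨x, field i x⟩ : TangentBundle I M)
  domain : Set M
  isOpen : IsOpen domain
  mem : x₀ ∈ domain
  subset : domain ⊆ frameDomain I x₀
  field_eq : ∀ i, ∀ y ∈ domain, field i y = frameSymm I x₀ y (Module.finBasis ℝ E i)

theorem contMDiffOn_frameSymm (x₀ : M) (u : E) :
    ContMDiffOn I I.tangent ∞ (fun y ↦ (⟨y, frameSymm I x₀ y u⟩ : TangentBundle I M))
      (frameDomain I x₀) := by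
  refine ((trivializationAt E (TangentSpace I : M → Type _) x₀).contMDiffOn_section_iff
    (isOpen_frameDomain x₀) Subset.rfl).2 ?_
  refine (contMDiffOn_const (c := u)).congr fun y hy ↦ ?_
  rw [trivializationAt_snd (I := I) ⟨y, _⟩ hy]
  exact frameCoord_frameSymm hy u

/-- Multiplying the frame of a trivialization by a bump function makes it globally smooth. -/
theorem nonempty_globalFrame [FiniteDimensional ℝ E] [T2Space M] (x₀ : M) :
    Nonempty (GlobalFrame I x₀) := by
  let ψ : SmoothBumpFunction I x₀ := Classical.arbitrary _
  obtain ⟨W, hW, hWo, hxW⟩ := eventually_nhds_iff.1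
    (ψ.eventuallyEq_one.and ((isOpen_frameDomain (I := I) x₀).mem_nhds (mem_frameDomain x₀)))
  refine ⟨⟨fun i y ↦ ψ y • frameSymm I x₀ y (Module.finBasis ℝ E i), fun i ↦ ?_, W, hWo, hxW,
    fun y hy ↦ (hW y hy).2, fun i y hy ↦ ?_⟩⟩
  · exact ContMDiffOn.smul_section_of_tsupport ψ.contMDiff.contMDiffOn (isOpen_frameDomain x₀)
      ψ.tsupport_subset_chartAt_source (contMDiffOn_frameSymm x₀ _)
  · have h1 : ψ y = 1 := (hW y hy).1
    simp only [h1, one_smul]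

variable (I) in
/-- The coordinates of a vector field in the trivialization of `TM` at `x₀`. -/
def localRep (x₀ : M) (X : ∀ x : M, TangentSpace I x) (y : M) : E := frameCoord I x₀ y (X y)

theorem contMDiffAt_localRep {x₀ y : M} (hy : y ∈ frameDomain I x₀)
    {X : ∀ x : M, TangentSpace I x}
    (hX : ContMDiff I I.tangent ∞ fun x ↦ (⟨x, X x⟩ : TangentBundle I M)) :
    ContMDiffAt I 𝓘(ℝ, E) ∞ (localRep I x₀ X) y :=
  (contMDiffAt_frameCoord (⟨y, X y⟩ : TangentBundle I M) hy).comp y (hX y)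

theorem hasDerivAt_localRep_comp {γ : ℝ → M} {t : ℝ}
    (hγ : MDifferentiableAt 𝓘(ℝ, ℝ) I γ t) {x₀ : M} {X : ∀ x : M, TangentSpace I x}
    (hX : ContMDiff I I.tangent ∞ fun x ↦ (⟨x, X x⟩ : TangentBundle I M))
    (ht : γ t ∈ frameDomain I x₀) :
    HasDerivAt (fun r ↦ localRep I x₀ X (γ r))
      (mvfderiv I (localRep I x₀ X) (γ t) (velocity I γ t)) t := by
  have h := HasMFDerivAt.comp t
    ((contMDiffAt_localRep ht hX).mdifferentiableAt (by simp)).hasMFDerivAt hγ.hasMFDerivAt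
  have h' : HasFDerivAt (fun r ↦ localRep I x₀ X (γ r))
    ((mvfderiv I (localRep I x₀ X) (γ t) : E →L[ℝ] E) ∘L (mfderiv 𝓘(ℝ, ℝ) I γ t : ℝ →L[ℝ] E)) t :=
    h.hasFDerivAt
  exact h'.hasDerivAt

namespace GlobalFrame

variable [FiniteDimensional ℝ E] {x₀ : M} (fr : GlobalFrame I x₀)

/-- The coordinate functions of the standard basis of `E`. -/
def coef (i : Fin (Module.finrank ℝ E)) : E →L[ℝ] ℝ :=
  LinearMap.toContinuousLinearMap ((Module.finBasis ℝ E).coord i)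

theorem sum_coef_smul (u : E) : ∑ i, coef i u • Module.finBasis ℝ E i = u :=
  (Module.finBasis ℝ E).sum_repr u

theorem sum_coef_smul_field {y : M} (hy : y ∈ fr.domain) (u : E) :
    ∑ i, coef i u • fr.field i y = frameSymm I x₀ y u := by
  simp_rw [fr.field_eq _ y hy, ← map_smul, ← map_sum]
  rw [sum_coef_smul]

theorem frameCoord_field {y : M} (hy : y ∈ fr.domain) (i : Fin (Module.finrank ℝ E)) :
    frameCoord I x₀ y (fr.field i y) = Module.finBasis ℝ E i := by
  rw [fr.field_eq i y hy, frameCoord_frameSymm (fr.subset hy)]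

/-- The connection form of `∇` in the frame: the endomorphism of `E` that represents
`c ↦ ∇_u (∑ cᵢ Sᵢ)` for constant coefficients `cᵢ`, where `Sᵢ` are the fields of the frame. -/
def connForm (cov : CovariantDerivative I E (TangentSpace I : M → Type _)) (y : M)
    (u : TangentSpace I y) : E →L[ℝ] E :=
  ∑ i, (coef i).smulRight (frameCoord I x₀ y (cov (fr.field i) y u))

theorem connForm_apply (cov : CovariantDerivative I E (TangentSpace I : M → Type _)) (y : M)
    (u : TangentSpace I y) (c : E) :
    fr.connForm cov y u c = ∑ i, coef i c • frameCoord I x₀ y (cov (fr.field i) y u) := by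
  simp [connForm]

/-- In coordinates, `∇_u X` is the derivative of `X` plus the connection form. -/
theorem frameCoord_cov (cov : CovariantDerivative I E (TangentSpace I : M → Type _))
    {X : ∀ x : M, TangentSpace I x}
    (hX : ContMDiff I I.tangent ∞ fun x ↦ (⟨x, X x⟩ : TangentBundle I M))
    {y : M} (hy : y ∈ fr.domain) (u : TangentSpace I y) :
    frameCoord I x₀ y (cov X y u) =
      mvfderiv I (localRep I x₀ X) y u + fr.connForm cov y u (localRep I x₀ X y) := by
  have hrep : MDifferentiableAt I 𝓘(ℝ, E) (localRep I x₀ X) y :=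
    (contMDiffAt_localRep (fr.subset hy) hX).mdifferentiableAt (by simp)
  have hc (i) : MDifferentiableAt I 𝓘(ℝ, ℝ) (fun z ↦ coef i (localRep I x₀ X z)) y :=
    (coef i).differentiableAt.mdifferentiableAt.comp y hrep
  have hS (i) : MDifferentiableAt I I.tangent
      (fun z ↦ (⟨z, fr.field i z⟩ : TangentBundle I M)) y :=
    (fr.smooth i y).mdifferentiableAt (by simp)
  have hcS (i) : MDifferentiableAt I I.tangent
      (fun z ↦ (⟨z, coef i (localRep I x₀ X z) • fr.field i z⟩ : TangentBundle I M)) y :=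
    (hc i).smul_section (hS i)
  have h1 : cov X y = cov (fun z ↦ ∑ i, coef i (localRep I x₀ X z) • fr.field i z) y := by
    refine cov.isCovariantDerivativeOnUniv.congr_of_eventuallyEq
      ((hX y).mdifferentiableAt (by simp)) (MDifferentiableAt.sum_section fun i _ ↦ hcS i)
      univ_mem ?_
    filter_upwards [fr.isOpen.mem_nhds hy] with z hz
    rw [fr.sum_coef_smul_field hz, localRep, frameSymm_frameCoord (fr.subset hz)]
  have h2 (i) : cov (fun z ↦ coef i (localRep I x₀ X z) • fr.field i z) y =
      coef i (localRep I x₀ X y) • cov (fr.field i) y +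
        (mvfderiv I (fun z ↦ coef i (localRep I x₀ X z)) y).smulRight (fr.field i y) :=
    cov.isCovariantDerivativeOnUniv.leibniz (hS i) (hc i)
  have h3 (i) : mvfderiv I (fun z ↦ coef i (localRep I x₀ X z)) y u =
      coef i (mvfderiv I (localRep I x₀ X) y u) := by
    have h := mvfderiv_comp_apply (g := coef (E := E) i) y
      (coef i).differentiableAt.mdifferentiableAt hrep u
    refine h.trans ?_
    rw [mvfderiv, mfderiv_eq_fderiv, ContinuousLinearMap.fderiv]
    rfl
  rw [h1, cov_sum cov _ hcS, _root_.sum_apply, map_sum, fr.connForm_apply]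
  simp_rw [h2]
  simp only [_root_.add_apply, _root_.smul_apply, ContinuousLinearMap.smulRight_apply, map_add,
    map_smul, fr.frameCoord_field hy, h3, Finset.sum_add_distrib, sum_coef_smul]
  rw [add_comm]

/-- The covariant derivative along a curve in coordinates: if `y` represents `Y`, then `y'`
represents `∇_{γ'} Y`, up to the connection form. The expansion of `Y` used in `HasCovDerivAlong`
is arbitrary, so that this also shows that the covariant derivative is unique. -/
theorem hasDerivAt_of_hasCovDerivAlong
    {cov : CovariantDerivative I E (TangentSpace I : M → Type _)} {γ : ℝ → M} {t : ℝ}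
    (ht : γ t ∈ fr.domain) {Y : ∀ t, TangentSpace I (γ t)} {w : TangentSpace I (γ t)}
    (h : HasCovDerivAlong cov γ Y t w) :
    HasDerivAt (fun r ↦ frameCoord I x₀ (γ r) (Y r))
      (frameCoord I x₀ (γ t) w -
        fr.connForm cov (γ t) (velocity I γ t) (frameCoord I x₀ (γ t) (Y t))) t := by
  obtain ⟨hγ, n, a, S, hS, ha, hY, rfl⟩ := h
  have h1 : HasDerivAt (fun r ↦ ∑ i, a i r • localRep I x₀ (S i) (γ r))
      (∑ i, (a i t • mvfderiv I (localRep I x₀ (S i)) (γ t) (velocity I γ t) +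
        deriv (a i) t • localRep I x₀ (S i) (γ t))) t :=
    HasDerivAt.fun_sum fun i _ ↦ (ha i).hasDerivAt.smul
      (hasDerivAt_localRep_comp hγ (hS i) (fr.subset ht))
  have h2 : (fun r ↦ frameCoord I x₀ (γ r) (Y r)) =ᶠ[𝓝 t]
      fun r ↦ ∑ i, a i r • localRep I x₀ (S i) (γ r) := by
    filter_upwards [hY] with r hr
    rw [hr, map_sum]
    simp only [map_smul, localRep]
  refine (h1.congr_of_eventuallyEq h2).congr_deriv ?_
  have h3 : frameCoord I x₀ (γ t) (Y t) = ∑ i, a i t • localRep I x₀ (S i) (γ t) :=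
    h2.self_of_nhds
  rw [h3, map_sum, map_sum, ← Finset.sum_sub_distrib]
  refine Finset.sum_congr rfl fun i _ ↦ ?_
  rw [map_add, map_smul, map_smul, map_smul, fr.frameCoord_cov cov (hS i) ht, smul_add]
  change _ = deriv (a i) t • localRep I x₀ (S i) (γ t) + _ - _
  abel

/-- Solutions of the parallel transport equation in coordinates give parallel fields. -/
theorem hasCovDerivAlong_frameSymm
    (cov : CovariantDerivative I E (TangentSpace I : M → Type _)) {γ : ℝ → M} {t : ℝ}
    (hγ : MDifferentiableAt 𝓘(ℝ, ℝ) I γ t) (ht : γ t ∈ fr.domain) {η : ℝ → E}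
    (hη : HasDerivAt η (-fr.connForm cov (γ t) (velocity I γ t) (η t)) t) :
    HasCovDerivAlong cov γ (fun r ↦ frameSymm I x₀ (γ r) (η r)) t 0 := by
  have ha (i) : HasDerivAt (fun r ↦ coef i (η r)) (coef i _) t :=
    (coef i).hasFDerivAt.comp_hasDerivAt t hη
  refine ⟨hγ, _, fun i r ↦ coef i (η r), fr.field, fr.smooth, fun i ↦ (ha i).differentiableAt,
    ?_, ?_⟩
  · filter_upwards [hγ.continuousAt.eventually_mem (fr.isOpen.mem_nhds ht)] with r hr
    exact (fr.sum_coef_smul_field hr _).symm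
  · have h1 : ∑ i, coef i (η t) • cov (fr.field i) (γ t) (velocity I γ t) =
        frameSymm I x₀ (γ t) (fr.connForm cov (γ t) (velocity I γ t) (η t)) := by
      rw [fr.connForm_apply, map_sum]
      simp_rw [map_smul, frameSymm_frameCoord (fr.subset ht)]
    rw [Finset.sum_add_distrib, h1]
    simp_rw [(ha _).deriv]
    rw [fr.sum_coef_smul_field ht, map_neg, neg_add_cancel]

theorem continuousAt_frameCoord_cov
    {cov : CovariantDerivative I E (TangentSpace I : M → Type _)} (hcov : PreservesSmooth cov)
    {γ : ℝ → M} {t : ℝ} (hγ : ContMDiffAt 𝓘(ℝ, ℝ) I ∞ γ t) (ht : γ t ∈ fr.domain)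
    {X : ∀ x : M, TangentSpace I x}
    (hX : ContMDiff I I.tangent ∞ fun x ↦ (⟨x, X x⟩ : TangentBundle I M)) :
    ContinuousAt (fun r ↦ frameCoord I x₀ (γ r) (cov X (γ r) (velocity I γ r))) t := by
  have hvel : ContinuousAt (fun r ↦ frameCoord I x₀ (γ r) (velocity I γ r)) t := by
    obtain ⟨u, hu, hγu⟩ := (contMDiffAt_iff_contMDiffOn_nhds (n := 1) (by simp)).1
      (hγ.of_le (by simp))
    obtain ⟨V, hVu, hVo, htV⟩ := mem_nhds_iff.1 hu
    have h1 := (hγu.mono hVu).continuousOn_tangentMapWithin le_rfl hVo.uniqueMDiffOn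
    have h2 : ContinuousOn (fun r : ℝ ↦ (⟨γ r, velocity I γ r⟩ : TangentBundle I M)) V := by
      have h3 : ContinuousOn (fun r : ℝ ↦ (⟨r, 1⟩ : TangentBundle 𝓘(ℝ, ℝ) ℝ)) V := by
        refine Continuous.continuousOn ?_
        exact (tangentBundleModelSpaceHomeomorph 𝓘(ℝ, ℝ)).symm.continuous.comp
          (continuous_id.prodMk continuous_const)
      refine (h1.comp h3 fun r hr ↦ hr).congr fun r hr ↦ ?_
      simp only [Function.comp, tangentMapWithin, velocity,
        mfderivWithin_of_isOpen hVo hr]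
      rfl
    exact ContinuousAt.comp (f := fun r : ℝ ↦ (⟨γ r, velocity I γ r⟩ : TangentBundle I M))
      (contMDiffAt_frameCoord _ (fr.subset ht)).continuousAt
      (h2.continuousAt (hVo.mem_nhds htV))
  have h1 (i) : ContinuousAt
      (fun r ↦ localRep I x₀ (fun y ↦ cov X y (fr.field i y)) (γ r)) t :=
    ContinuousAt.comp
      (contMDiffAt_localRep (fr.subset ht) (hcov _ _ (fr.smooth i) hX)).continuousAt
      hγ.continuousAt
  have h2 : ContinuousAt (fun r ↦ ∑ i, coef i (frameCoord I x₀ (γ r) (velocity I γ r)) •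
      localRep I x₀ (fun y ↦ cov X y (fr.field i y)) (γ r)) t :=
    tendsto_finsetSum _ fun i _ ↦
      ((coef i).continuous.continuousAt.comp hvel).smul (h1 i)
  refine h2.congr ?_
  filter_upwards [hγ.continuousAt.eventually_mem (fr.isOpen.mem_nhds ht)] with r hr
  have h3 := fr.sum_coef_smul_field hr (frameCoord I x₀ (γ r) (velocity I γ r))
  rw [frameSymm_frameCoord (fr.subset hr)] at h3
  conv_rhs => rw [← h3]
  simp only [map_sum, map_smul, localRep]

theorem continuousAt_connForm
    {cov : CovariantDerivative I E (TangentSpace I : M → Type _)} (hcov : PreservesSmooth cov)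
    {γ : ℝ → M} {t : ℝ} (hγ : ContMDiffAt 𝓘(ℝ, ℝ) I ∞ γ t) (ht : γ t ∈ fr.domain) :
    ContinuousAt (fun r ↦ fr.connForm cov (γ r) (velocity I γ r)) t := by
  unfold connForm
  refine tendsto_finsetSum _ fun i _ ↦ ?_
  exact ((ContinuousLinearMap.smulRightL ℝ E E (coef i)).continuous.continuousAt.comp
    (fr.continuousAt_frameCoord_cov hcov hγ ht (fr.smooth i)))

end GlobalFrame

/-! ### Parallel transport -/

namespace GlobalFrame

variable [FiniteDimensional ℝ E] {x₀ : M} (fr : GlobalFrame I x₀)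
  {cov : CovariantDerivative I E (TangentSpace I : M → Type _)} {γ : ℝ → M}

/-- At the parameter `r`, the curve `γ` lies in the frame, `P` solves the equation of parallel
transport along `γ` in coordinates, and `Q` is the inverse of `P`. -/
structure IsTransportPair (cov : CovariantDerivative I E (TangentSpace I : M → Type _))
    (γ : ℝ → M) (P Q : ℝ → E →L[ℝ] E) (r : ℝ) : Prop where
  mem : γ r ∈ fr.domain
  mdifferentiableAt : MDifferentiableAt 𝓘(ℝ, ℝ) I γ r
  hasDerivAt : HasDerivAt P (-(fr.connForm cov (γ r) (velocity I γ r) * P r)) r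
  hasDerivAt_inv : HasDerivAt Q (Q r * fr.connForm cov (γ r) (velocity I γ r)) r
  mul_inv : P r * Q r = 1
  inv_mul : Q r * P r = 1

theorem exists_isTransportPair (hcov : PreservesSmooth cov)
    (hγ : ∀ᶠ t in 𝓝 0, ContMDiffAt 𝓘(ℝ, ℝ) I ∞ γ t) (h0 : γ 0 ∈ fr.domain) :
    ∃ P Q : ℝ → E →L[ℝ] E, Q 0 = 1 ∧ ∀ᶠ r in 𝓝 0, fr.IsTransportPair cov γ P Q r := by
  have : CompleteSpace E := FiniteDimensional.complete ℝ E
  have hmem : ∀ᶠ t in 𝓝 0, γ t ∈ fr.domain :=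
    hγ.self_of_nhds.continuousAt.eventually_mem (fr.isOpen.mem_nhds h0)
  obtain ⟨P, Q, hQ, h⟩ := exists_fundamentalSolution
    (A := fun r ↦ fr.connForm cov (γ r) (velocity I γ r)) (by
      filter_upwards [hγ, hmem] with t h1 h2
      exact fr.continuousAt_connForm hcov h1 h2)
  refine ⟨P, Q, hQ, ?_⟩
  filter_upwards [h, hγ, hmem] with t h1 h2 h3
  exact ⟨h3, h2.mdifferentiableAt (by simp), h1.1, h1.2.1, h1.2.2.1, h1.2.2.2⟩

/-- Parallel transport from `s` to `t` is `P(t) Q(s)` in coordinates. -/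
theorem parallelTransport_eq {P Q : ℝ → E →L[ℝ] E} {U : Set ℝ} (hU : IsOpen U)
    (h : ∀ r ∈ U, fr.IsTransportPair cov γ P Q r) {s t : ℝ} (hst : uIcc s t ⊆ U)
    (p : TangentBundle I M) (hp : p.1 = γ s) :
    parallelTransport cov γ t s p =
      ⟨γ t, frameSymm I x₀ (γ t) (P t (Q s (frameCoord I x₀ p.1 p.2)))⟩ := by
  obtain ⟨y, u⟩ := p
  obtain rfl : y = γ s := hp
  have hs := h s (hst left_mem_uIcc)
  have ht := h t (hst right_mem_uIcc)
  have hex : ∃ Y : ∀ r, TangentSpace I (γ r),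
      (∃ U : Set ℝ, IsOpen U ∧ uIcc s t ⊆ U ∧ IsParallelOn cov γ Y U) ∧
      (⟨γ s, Y s⟩ : TangentBundle I M) = ⟨γ s, u⟩ := by
    refine ⟨fun r ↦ frameSymm I x₀ (γ r) (P r (Q s (frameCoord I x₀ (γ s) u))),
      ⟨U, hU, hst, fun r hr ↦ ?_⟩, ?_⟩
    · refine fr.hasCovDerivAlong_frameSymm cov (h r hr).mdifferentiableAt (h r hr).mem ?_
      simpa using (h r hr).hasDerivAt.clm_apply (hasDerivAt_const r (Q s (frameCoord I x₀ (γ s) u)))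
    · congr 1
      have h1 : P s (Q s (frameCoord I x₀ (γ s) u)) = frameCoord I x₀ (γ s) u :=
        DFunLike.congr_fun hs.mul_inv _
      change frameSymm I x₀ (γ s) (P s (Q s (frameCoord I x₀ (γ s) u))) = u
      rw [h1, frameSymm_frameCoord (fr.subset hs.mem)]
  rw [parallelTransport, dif_pos hex]
  obtain ⟨⟨U', hU', hstU', hY⟩, hYs⟩ := hex.choose_spec
  set Y := hex.choose
  have hYs : Y s = u := by simpa using hYs
  -- For the chosen parallel field `Y` with coordinates `y`, the curve `Q y` has derivative
  -- `Q A y - Q A y = 0`, so that `Y` is the field constructed above.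
  have hconst : ∀ r ∈ uIcc s t,
      HasDerivAt (fun r ↦ Q r (frameCoord I x₀ (γ r) (Y r))) 0 r := fun r hr ↦ by
    have h1 := fr.hasDerivAt_of_hasCovDerivAlong (h r (hst hr)).mem (hY r (hstU' hr))
    have h2 := (h r (hst hr)).hasDerivAt_inv.clm_apply h1
    refine h2.congr_deriv ?_
    simp
  have hQ : Q t (frameCoord I x₀ (γ t) (Y t)) = Q s (frameCoord I x₀ (γ s) u) := by
    rw [← hYs]
    have h1 := (convex_uIcc s t).norm_image_sub_le_of_norm_hasDerivWithin_le (C := 0)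
      (fun r hr ↦ (hconst r hr).hasDerivWithinAt) (fun _ _ ↦ norm_zero.le)
      left_mem_uIcc right_mem_uIcc
    rw [zero_mul, norm_le_zero_iff, sub_eq_zero] at h1
    exact h1
  congr 1
  rw [← hQ]
  have h1 : P t (Q t (frameCoord I x₀ (γ t) (Y t))) = frameCoord I x₀ (γ t) (Y t) :=
    DFunLike.congr_fun ht.mul_inv _
  rw [h1, frameSymm_frameCoord (fr.subset ht.mem)]

end GlobalFrame

/-- Translating by the flow of `X^V` at `γ(t)` and back at `γ(0)`, with parallel transport in
between, moves `v ∈ T_x M` by `t (g(t) - g(0))`. Here `g(t)` is the parallel transport of `X(γ(t))`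
to `T_x M`, so that `g'(0)` is the covariant derivative of `X` in the direction of `γ'(0)`. -/
theorem exists_fibre_curve [FiniteDimensional ℝ E] [I.Boundaryless] [T2Space M]
    {cov : CovariantDerivative I E (TangentSpace I : M → Type _)} (hcov : PreservesSmooth cov)
    {X Z : ∀ x : M, TangentSpace I x}
    (hX : ContMDiff I I.tangent ∞ fun x ↦ (⟨x, X x⟩ : TangentBundle I M))
    {γ : ℝ → M} (hγ : ∀ᶠ t in 𝓝 0, ContMDiffAt 𝓘(ℝ, ℝ) I ∞ γ t) {x : M}
    (h0 : (⟨γ 0, velocity I γ 0⟩ : TangentBundle I M) = ⟨x, Z x⟩) :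
    ∃ g g' : ℝ → E, (∀ᶠ t in 𝓝 0, HasDerivAt g (g' t) t) ∧ ContinuousAt g' 0 ∧
      g' 0 = cov X x (Z x) ∧
      ∀ᶠ t in 𝓝 0, ∀ v : E, flow (verticalLift X) (-t) (parallelTransport cov γ 0 t
        (flow (verticalLift X) t (parallelTransport cov γ t 0 (fibreInclusion I x v)))) =
          fibreInclusion I x (v + t • (g t - g 0)) := by
  obtain ⟨fr⟩ := nonempty_globalFrame (I := I) x
  have hx : γ 0 = x := congrArg TotalSpace.proj h0
  subst hx
  have hvel : velocity I γ 0 = Z (γ 0) := by simpa using h0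
  obtain ⟨P, Q, hQ0, hPQ⟩ := fr.exists_isTransportPair hcov hγ fr.mem
  obtain ⟨δ, hδ, hPQδ⟩ := Metric.eventually_nhds_iff_ball.1 hPQ
  have hnear := Metric.ball_mem_nhds (0 : ℝ) hδ
  let F : E →L[ℝ] E := frameSymm I (γ 0) (γ 0)
  let k : ℝ → E := fun r ↦ frameCoord I (γ 0) (γ r) (cov X (γ r) (velocity I γ r))
  refine ⟨fun r ↦ F (Q r (localRep I (γ 0) X (γ r))), fun r ↦ F (Q r (k r)), ?_, ?_, ?_, ?_⟩
  · filter_upwards [hPQ] with r hr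
    refine F.hasFDerivAt.comp_hasDerivAt r ?_
    have h1 := hr.hasDerivAt_inv.clm_apply
      (hasDerivAt_localRep_comp hr.mdifferentiableAt hX (fr.subset hr.mem))
    refine h1.congr_deriv ?_
    simp only [k]
    rw [fr.frameCoord_cov cov hX hr.mem, map_add, add_comm]
    rfl
  · exact F.continuous.continuousAt.comp (hPQ.self_of_nhds.hasDerivAt_inv.continuousAt.clm_apply
      (fr.continuousAt_frameCoord_cov hcov hγ.self_of_nhds fr.mem hX))
  · simp only [hQ0, k, F, hvel]
    exact frameSymm_frameCoord (mem_frameDomain _) _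
  · filter_upwards [hnear] with t ht v
    have hsub : uIcc 0 t ⊆ Metric.ball 0 δ := by
      intro r hr
      rw [mem_ball_zero_iff, Real.norm_eq_abs] at ht ⊢
      rw [mem_uIcc] at hr
      rw [abs_lt] at ht ⊢
      rcases hr with hr | hr <;> constructor <;> linarith
    have ht' := hPQδ t ht
    have hcomp (c : E) : Q t (P t c) = c := DFunLike.congr_fun ht'.inv_mul c
    have hQ1 (c : E) : Q 0 c = c := by rw [hQ0]; rfl
    have hP1 (c : E) : P 0 c = c := by
      have := DFunLike.congr_fun (hPQ.self_of_nhds).mul_inv c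
      simpa [hQ0] using this
    rw [fr.parallelTransport_eq Metric.isOpen_ball hPQδ hsub (fibreInclusion I (γ 0) v) rfl,
      flow_verticalLift X t,
      fr.parallelTransport_eq Metric.isOpen_ball hPQδ (uIcc_comm t 0 ▸ hsub) _ rfl,
      flow_verticalLift]
    refine eq_mk_of_frameCoord_eq rfl ?_
    have hm := mem_frameDomain (I := I) (γ 0)
    let C : E →L[ℝ] E := frameCoord I (γ 0) (γ 0)
    have hCF (c : E) : C (F c) = c := frameCoord_frameSymm hm c
    have hrhs (a b : E) : C (v + t • (F a - F b)) = C v + t • (a - b) := by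
      rw [map_add, map_smul, map_sub, hCF, hCF]
    refine Eq.trans ?_ (hrhs _ _).symm
    simp only [fibreInclusion, map_add, map_smul, frameCoord_frameSymm hm,
      frameCoord_frameSymm (fr.subset ht'.mem), hcomp, hQ1, hP1, smul_sub, neg_smul, map_neg,
      localRep]
    change C v + _ + -_ = _
    abel

/-! ### The second derivative -/

section Calculus

variable {G : Type*} [NormedAddCommGroup G] [NormedSpace ℝ G]

theorem hasDerivAt_id_smul_of_continuousAt {k : ℝ → G} (hk : ContinuousAt k 0) :
    HasDerivAt (fun t : ℝ ↦ t • k t) (k 0) 0 := by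
  rw [hasDerivAt_iff_tendsto_slope]
  refine (hk.tendsto.mono_left nhdsWithin_le_nhds).congr' ?_
  filter_upwards [self_mem_nhdsWithin] with t ht
  have ht : t ≠ 0 := ht
  simp [slope_def_module, smul_smul, inv_mul_cancel₀ ht]

/-- At a critical point of `h`, the second derivative of `φ ∘ h` does not involve the second
derivative of `φ`. -/
theorem hasDerivAt_deriv_comp_of_critical {φ : G → ℝ} {h h' : ℝ → G} {w : G}
    (hφ : ContDiffAt ℝ 2 φ (h 0)) (hh : ∀ᶠ t in 𝓝 0, HasDerivAt h (h' t) t) (h0 : h' 0 = 0)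
    (hw : HasDerivAt h' w 0) :
    HasDerivAt (deriv (φ ∘ h)) (fderiv ℝ φ (h 0) w) 0 := by
  have hcont : ContinuousAt h 0 := hh.self_of_nhds.continuousAt
  have hev : ∀ᶠ t in 𝓝 0, deriv (φ ∘ h) t = fderiv ℝ φ (h t) (h' t) := by
    filter_upwards [hh, hcont.eventually (hφ.eventually (by simp))] with t ht hφt
    exact ((hφt.differentiableAt (by simp)).hasFDerivAt.comp_hasDerivAt t ht).deriv
  have h1 : DifferentiableAt ℝ (fderiv ℝ φ) (h 0) :=
    (hφ.fderiv_right (m := 1) (by norm_num)).differentiableAt (by simp)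
  have h2 := (h1.hasFDerivAt.comp_hasDerivAt 0 hh.self_of_nhds).clm_apply hw
  refine (h2.congr_of_eventuallyEq hev).congr_deriv ?_
  simp [h0]

end Calculus

/-- A curve in a fibre that is critical at `0` has there the vertical lift of its ordinary second
derivative as its second derivative. -/
theorem hasSecondDerivAt_fibreInclusion {x : M} {v w : E} {c : ℝ → TangentBundle I M}
    {h h' : ℝ → E} (hc : ∀ᶠ t in 𝓝 0, c t = fibreInclusion I x (h t)) (hv : h 0 = v)
    (hh : ∀ᶠ t in 𝓝 0, HasDerivAt h (h' t) t) (h0 : h' 0 = 0) (hw : HasDerivAt h' w 0) :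
    HasSecondDerivAt I.tangent c 0 (⟨x, v⟩ : TangentBundle I M)
      (vlft (I := I) (x := x) v w) := by
  subst hv
  have hκ (u : E) : MDifferentiableAt 𝓘(ℝ, E) I.tangent (fibreInclusion I x) u :=
    (contMDiff_fibreInclusion x u).mdifferentiableAt (by simp)
  refine ⟨hc.self_of_nhds, ?_, ?_, fun f hf ↦ ?_⟩
  · filter_upwards [hc.eventually_nhds, hh] with t ht hht
    exact ((hκ (h t)).comp t hht.differentiableAt.mdifferentiableAt).congr_of_eventuallyEq ht
  · have h1 : HasMFDerivAt 𝓘(ℝ, ℝ) 𝓘(ℝ, E) h 0 (0 : ℝ →L[ℝ] E) := by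
      have h2 := hh.self_of_nhds
      rw [h0] at h2
      have h3 : HasFDerivAt h (0 : ℝ →L[ℝ] E) 0 := by
        simpa using h2.hasFDerivAt
      exact h3.hasMFDerivAt
    have h4 := HasMFDerivAt.comp 0 (hκ (h 0)).hasMFDerivAt h1
    refine (h4.congr_of_eventuallyEq hc).congr_mfderiv ?_
    exact ContinuousLinearMap.comp_zero (σ₁₂ := RingHom.id ℝ) (M₂ := E) (M₃ := E × E) _
  · let φ : E → ℝ := f ∘ fibreInclusion I x
    have hφ : ContMDiffAt 𝓘(ℝ, E) 𝓘(ℝ, ℝ) ∞ φ (h 0) :=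
      hf.comp (h 0) (contMDiff_fibreInclusion x (h 0))
    have h1 := hasDerivAt_deriv_comp_of_critical (hφ.contDiffAt.of_le (by norm_cast)) hh h0 hw
    have h2 : deriv (f ∘ c) =ᶠ[𝓝 0] deriv (φ ∘ h) := by
      refine EventuallyEq.deriv ?_
      filter_upwards [hc] with t ht
      simp only [Function.comp, ht, φ]
    refine (h1.congr_of_eventuallyEq h2).congr_deriv ?_
    rw [← mfderiv_eq_fderiv]
    exact (mfderiv_vlft (J := 𝓘(ℝ, ℝ)) (⟨x, h 0⟩ : TangentBundle I M)
      (hf.mdifferentiableAt (by simp)) w).symm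

theorem hasSecondDerivAt_upsilon [FiniteDimensional ℝ E] [I.Boundaryless] [T2Space M]
    {cov : CovariantDerivative I E (TangentSpace I : M → Type _)} (hcov : PreservesSmooth cov)
    {X₁ X₂ : ∀ x : M, TangentSpace I x}
    (hX₁ : ContMDiff I I.tangent ∞ fun x ↦ (⟨x, X₁ x⟩ : TangentBundle I M))
    (hX₂ : ContMDiff I I.tangent ∞ fun x ↦ (⟨x, X₂ x⟩ : TangentBundle I M))
    {x : M} (v : E) {γ₁ γ₂ : ℝ → M}
    (hγ₁ : ∀ᶠ t in 𝓝 0, ContMDiffAt 𝓘(ℝ, ℝ) I ∞ γ₁ t)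
    (hγ₂ : ∀ᶠ t in 𝓝 0, ContMDiffAt 𝓘(ℝ, ℝ) I ∞ γ₂ t)
    (h₁ : (⟨γ₁ 0, velocity I γ₁ 0⟩ : TangentBundle I M) = ⟨x, X₁ x⟩)
    (h₂ : (⟨γ₂ 0, velocity I γ₂ 0⟩ : TangentBundle I M) = ⟨x, X₂ x⟩) :
    HasSecondDerivAt I.tangent (upsilon cov X₁ X₂ γ₁ γ₂ (⟨x, v⟩ : TangentBundle I M)) 0
      (⟨x, v⟩ : TangentBundle I M)
      (vlft (I := I) (x := x) v ((2 : ℝ) • symmetricProduct cov X₁ X₂ x)) := by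
  obtain ⟨g₁, g₁', hg₁, hg₁c, hg₁0, hloop₁⟩ := exists_fibre_curve hcov hX₁ hγ₂ h₂
  obtain ⟨g₂, g₂', hg₂, hg₂c, hg₂0, hloop₂⟩ := exists_fibre_curve hcov hX₂ hγ₁ h₁
  have hk0 : g₁' 0 + g₂' 0 = symmetricProduct cov X₁ X₂ x := by
    rw [hg₁0, hg₂0, symmetricProduct, add_comm]; rfl
  refine hasSecondDerivAt_fibreInclusion
    (h := fun t ↦ v + t • (g₁ t - g₁ 0) + t • (g₂ t - g₂ 0))
    (h' := fun t ↦ ((g₁ t - g₁ 0) + t • g₁' t) + ((g₂ t - g₂ 0) + t • g₂' t)) ?_ (by simp) ?_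
    (by simp) ?_
  · filter_upwards [hloop₁, hloop₂] with t ht₁ ht₂
    rw [← ht₂, ← ht₁]
    rfl
  · filter_upwards [hg₁, hg₂] with t ht₁ ht₂
    have h1 := (hasDerivAt_id t).smul (ht₁.sub_const (g₁ 0))
    have h2 := (hasDerivAt_id t).smul (ht₂.sub_const (g₂ 0))
    refine ((h1.const_add v).add h2).congr_deriv ?_
    simp only [id, one_smul]
    abel
  · have h1 := (hg₁.self_of_nhds.sub_const (g₁ 0)).add (hasDerivAt_id_smul_of_continuousAt hg₁c)
    have h2 := (hg₂.self_of_nhds.sub_const (g₂ 0)).add (hasDerivAt_id_smul_of_continuousAt hg₂c)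
    refine (h1.add h2).congr_deriv ?_
    refine Eq.trans ?_ (congrArg (fun u : E ↦ (2 : ℝ) • u) hk0)
    simp only [two_smul]
    abel

end SymProd

end

theorem theorem3p4
    {E : Type*} [NormedAddCommGroup E] [NormedSpace ℝ E] [FiniteDimensional ℝ E]
    {H : Type*} [TopologicalSpace H] (I : ModelWithCorners ℝ E H) [I.Boundaryless]
    {M : Type*} [TopologicalSpace M] [ChartedSpace H M] [IsManifold I ∞ M]
    [T2Space M] [ParacompactSpace M]
    (cov : CovariantDerivative I E (TangentSpace I : M → Type _))
    [CovariantDerivative.ContMDiffCovariantDerivative cov ∞]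
    (X₁ X₂ : ∀ x : M, TangentSpace I x)
    (hX₁ : ContMDiff I I.tangent ∞ fun x ↦ (⟨x, X₁ x⟩ : TangentBundle I M))
    (hX₂ : ContMDiff I I.tangent ∞ fun x ↦ (⟨x, X₂ x⟩ : TangentBundle I M))
    (x : M) (v : TangentSpace I x)
    (γ₁ γ₂ : ℝ → M) (J₁ J₂ : Set ℝ)
    (hJ₁ : IsOpen J₁ ∧ J₁.OrdConnected ∧ (0 : ℝ) ∈ J₁)
    (hJ₂ : IsOpen J₂ ∧ J₂.OrdConnected ∧ (0 : ℝ) ∈ J₂)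
    (hγ₁ : SymProd.IsGeodesicOn cov γ₁ J₁)
    (hγ₂ : SymProd.IsGeodesicOn cov γ₂ J₂)
    (hγ₁_init : (⟨γ₁ 0, SymProd.velocity I γ₁ 0⟩ : TangentBundle I M) = ⟨x, X₁ x⟩)
    (hγ₂_init : (⟨γ₂ 0, SymProd.velocity I γ₂ 0⟩ : TangentBundle I M) = ⟨x, X₂ x⟩)
    (Υ : ℝ → TangentBundle I M)
    (hΥ : Υ = SymProd.upsilon cov X₁ X₂ γ₁ γ₂ ⟨x, v⟩ ∨
      Υ = SymProd.upsilon (SymProd.torsionFree cov) X₁ X₂ γ₁ γ₂ ⟨x, v⟩) :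
    HasMFDerivAt 𝓘(ℝ, ℝ) I.tangent Υ 0 0 ∧
    ∃ w : TangentSpace I.tangent (⟨x, v⟩ : TangentBundle I M),
      SymProd.HasSecondDerivAt I.tangent Υ 0 ⟨x, v⟩ w ∧
      (1 / 2 : ℝ) • w =
        SymProd.verticalLift (SymProd.symmetricProduct cov X₁ X₂) ⟨x, v⟩ := by
  have hsmooth {γ : ℝ → M} {J : Set ℝ} (hJ : IsOpen J ∧ J.OrdConnected ∧ (0 : ℝ) ∈ J)
      (hγ : SymProd.IsGeodesicOn cov γ J) :
      ∀ᶠ t in 𝓝 0, ContMDiffAt 𝓘(ℝ, ℝ) I ∞ γ t := by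
    filter_upwards [hJ.1.mem_nhds hJ.2.2] with t ht
    exact hγ.1.contMDiffAt (hJ.1.mem_nhds ht)
  have hsec : SymProd.HasSecondDerivAt I.tangent Υ 0 ⟨x, v⟩
      (SymProd.vlft v ((2 : ℝ) • SymProd.symmetricProduct cov X₁ X₂ x)) := by
    have hcov := SymProd.preservesSmooth cov
    obtain rfl | rfl := hΥ
    · exact SymProd.hasSecondDerivAt_upsilon hcov hX₁ hX₂ v (hsmooth hJ₁ hγ₁) (hsmooth hJ₂ hγ₂)
        hγ₁_init hγ₂_init
    · rw [← SymProd.symmetricProduct_torsionFree]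
      exact SymProd.hasSecondDerivAt_upsilon (SymProd.preservesSmooth_torsionFree hcov) hX₁ hX₂ v
        (hsmooth hJ₁ hγ₁) (hsmooth hJ₂ hγ₂) hγ₁_init hγ₂_init
  refine ⟨hsec.critical, _, hsec, ?_⟩
  let L : E →L[ℝ] E × E := mfderiv 𝓘(ℝ, E) I.tangent (SymProd.fibreInclusion I x) v
  let u : E := SymProd.symmetricProduct cov X₁ X₂ x
  have h1 : (1 / 2 : ℝ) • L ((2 : ℝ) • u) = L u := by
    rw [map_smul, smul_smul]; norm_num
  have h2 := SymProd.vlft_eq (I := I) x v ((2 : ℝ) • u)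
  have h3 := SymProd.vlft_eq (I := I) x v u
  exact (congrArg (fun z : E × E ↦ (1 / 2 : ℝ) • z) h2).trans (h1.trans h3.symm)
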